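/- Let $\alpha=(\alpha_1,\alpha_2,\ldots,\alpha_{2s})$ be a composition of $n$ (positive integer parts with sum $n$) with an even number of parts. The circular fence poset $\overline{F}(\alpha)$ has the $n$ nodes $x_1,\ldots,x_n$; with $x_{n+1}=x_1$, its order is generated by the relations $$x_1\preceq x_2\preceq\cdots\preceq x_{\alpha_1+1}\succeq x_{\alpha_1+2}\succeq\cdots\succeq x_{\alpha_1+\alpha_2+1}\preceq\cdots\succeq x_{n+1}=x_1 ,$$ which alternate between $\alpha_1$ up steps, $\alpha_2$ down steps, $\alpha_3$ up steps, and so on. Let $\overline{R}(\alpha;q)=\sum_I q^{|I|}=\sum_{i=0}^n r_i q^i$, where $I$ runs over the lower order ideals of $\overline{F}(\alpha)$. A sequence $a_0,\ldots,a_n$ is unimodal if $a_0\le\cdots\le a_m\ge\cdots\ge a_n$ for some index $m$. 1. If $n$ is odd, then $\overline{R}(\alpha;q)$ is unimodal, that is, $r_0,\ldots,r_n$ is unimodal. 2. If $n=2t$, then $r_i\ge r_{i-1}$ for all $1\le i<t$, and $r_i\ge r_{i+1}$ for all $t<i<n$. So unimodality can only fail at the middle term: if $r_0,\ldots,r_n$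 is not unimodal, then $r_t<r_{t-1}$ and $r_t<r_{t+1}$. -/

import Mathlib

/-- The rank polynomial of the lattice of lower order ideals of a finite poset `P`:
`∑_I q ^ |I|`, the sum running over all lower order ideals `I` of `P`. -/
noncomputable def rankPolynomial (P : Type*) [PartialOrder P] [Fintype P] : Polynomial ℕ :=
  open Classical in
  ∑ I ∈ Finset.univ.filter (fun I : Finset P => IsLowerSet (I : Set P)),
    (Polynomial.X : Polynomial ℕ) ^ (Finset.card I)

/-- The sequence `a 0, a 1, …, a n` is unimodal. -/
def IsUnimodal (a : ℕ → ℕ) (n : ℕ) : Prop :=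
  ∃ m ≤ n, (∀ i < m, a i ≤ a (i + 1)) ∧ (∀ i, m ≤ i → i < n → a (i + 1) ≤ a i)

/-- The nodes of the circular fence of a composition `α` of `n` with an even number of parts.
The element `i : Fin n` is the node `x_{i+1}`. -/
def CircularFence {n : ℕ} (α : Composition n) (_hα : Even α.length) : Type := Fin n

namespace CircularFence

variable {n : ℕ} {α : Composition n} {hα : Even α.length}

instance : Fintype (CircularFence α hα) := inferInstanceAs (Fintype (Fin n))

instance : DecidableEq (CircularFence α hα) := inferInstanceAs (DecidableEq (Fin n))

/-- The defining relations `x ≼ y` between cyclically adjacent nodes. The `i`-th step joins node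
`i` to its cyclic successor `finRotate n i` (that is `i + 1` modulo `n`, which encodes
`x_{n+1} = x_1`); it belongs to the segment `α.index i`. Segments are numbered from `0` here, so
even-numbered segments go up and odd-numbered segments go down. -/
def Step (α : Composition n) (x y : Fin n) : Prop :=
  (y = finRotate n x ∧ Even (α.index x : ℕ)) ∨ (x = finRotate n y ∧ Odd (α.index y : ℕ))

/-- Auxiliary height function, used only to show that the relations are acyclic: it runs
linearly from `0` to `1` along up segments and from `1` to `0` along down segments. -/
def height (α : Composition n) (x : Fin n) : ℚ :=
  if Even (α.index x : ℕ) then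
    ((α.invEmbedding x : ℕ) : ℚ) / (α.blocksFun (α.index x) : ℚ)
  else 1 - ((α.invEmbedding x : ℕ) : ℚ) / (α.blocksFun (α.index x) : ℚ)

theorem succ_cases (α : Composition n) (hα : Even α.length) (x : Fin n) :
    (α.index (finRotate n x) = α.index x ∧
      (α.invEmbedding (finRotate n x) : ℕ) = (α.invEmbedding x : ℕ) + 1) ∨
    ((Even (α.index (finRotate n x) : ℕ) ↔ ¬ Even (α.index x : ℕ)) ∧
      (α.invEmbedding (finRotate n x) : ℕ) = 0) := by
  have idx : ∀ (z : Fin n) (j : Fin α.length), α.sizeUpTo j ≤ z → (z : ℕ) < α.sizeUpTo (j + 1) →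
      α.index z = j := by
    intro z j h1 h2
    exact (α.mem_range_embedding_iff'.1 (α.mem_range_embedding_iff.2 ⟨h1, h2⟩)).symm
  have hpos : 0 < α.length := (Nat.zero_le _).trans_lt (α.index x).2
  have lo := α.sizeUpTo_index_le x
  have hi : (x : ℕ) < α.sizeUpTo ((α.index x : ℕ) + 1) := α.lt_sizeUpTo_index_succ x
  have hval : (finRotate n x : ℕ) = if (x : ℕ) + 1 = n then 0 else (x : ℕ) + 1 := by
    cases n with
    | zero => exact x.elim0
    | succ m =>
      rw [coe_finRotate]
      simp [Fin.ext_iff]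
  by_cases hsame : (x : ℕ) + 1 < α.sizeUpTo ((α.index x : ℕ) + 1)
  · have hle := α.sizeUpTo_le ((α.index x : ℕ) + 1)
    rw [if_neg (by omega)] at hval
    have hindex := idx (finRotate n x) (α.index x) (by omega) (by omega)
    refine Or.inl ⟨hindex, ?_⟩
    rw [Composition.coe_invEmbedding, Composition.coe_invEmbedding, hindex]
    omega
  · refine Or.inr ?_
    by_cases hlast : (α.index x : ℕ) + 1 < α.length
    · have hlt := α.sizeUpTo_strict_mono hlast
      have hle := α.sizeUpTo_le ((α.index x : ℕ) + 1 + 1)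
      rw [if_neg (by omega)] at hval
      have hindex := idx (finRotate n x) ⟨(α.index x : ℕ) + 1, hlast⟩
        (by simp only; omega) (by simp only; omega)
      rw [Composition.coe_invEmbedding, hindex]
      exact ⟨Nat.even_add_one, by simp only; omega⟩
    · have hn := α.sizeUpTo_ofLength_le ((α.index x : ℕ) + 1) (by omega)
      rw [if_pos (by omega)] at hval
      have h0 : α.sizeUpTo 0 = 0 := α.sizeUpTo_zero
      have hlt := α.sizeUpTo_strict_mono hpos
      have hindex := idx (finRotate n x) ⟨0, hpos⟩
        (by simp only; omega) (by simp only; omega)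
      have hx : (α.index x : ℕ) + 1 = α.length := by omega
      rw [Composition.coe_invEmbedding, hindex]
      rw [← hx, Nat.even_add_one] at hα
      exact ⟨by simp [hα], by simp only; omega⟩

theorem height_lt (α : Composition n) (hα : Even α.length) {x y : Fin n} (h : Step α x y) :
    height α x < height α y := by
  have key : ∀ z : Fin n, 0 ≤ ((α.invEmbedding z : ℕ) : ℚ) / (α.blocksFun (α.index z) : ℚ) ∧
      ((α.invEmbedding z : ℕ) : ℚ) / (α.blocksFun (α.index z) : ℚ) < 1 := by
    intro z
    have h1 : ((α.invEmbedding z : ℕ)) < α.blocksFun (α.index z) := (α.invEmbedding z).2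
    have h2 : ((α.invEmbedding z : ℕ) : ℚ) < (α.blocksFun (α.index z) : ℚ) := by exact_mod_cast h1
    have h3 : (0 : ℚ) < (α.blocksFun (α.index z) : ℚ) :=
      lt_of_le_of_lt (Nat.cast_nonneg _) h2
    exact ⟨by positivity, (div_lt_one h3).2 h2⟩
  have inc : ∀ z : Fin n, α.index (finRotate n z) = α.index z →
      (α.invEmbedding (finRotate n z) : ℕ) = (α.invEmbedding z : ℕ) + 1 →
      ((α.invEmbedding z : ℕ) : ℚ) / (α.blocksFun (α.index z) : ℚ) <
      ((α.invEmbedding (finRotate n z) : ℕ) : ℚ) /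
        (α.blocksFun (α.index (finRotate n z)) : ℚ) := by
    intro z h1 h2
    have h3 : (0 : ℚ) < (α.blocksFun (α.index z) : ℚ) := by
      exact_mod_cast α.blocks_pos' _ (α.index z).2
    rw [h2, h1]
    gcongr
    simp
  rcases h with ⟨rfl, h⟩ | ⟨rfl, h⟩
  · rcases succ_cases α hα x with ⟨h1, h2⟩ | ⟨h1, h2⟩
    · have := inc x h1 h2
      rw [height, height, if_pos h, if_pos (by rw [h1]; exact h)]
      exact this
    · have := (key x).2
      rw [height, height, if_pos h, if_neg (by rw [h1]; exact not_not.2 h), h2]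
      simpa using this
  · rw [← Nat.not_even_iff_odd] at h
    rcases succ_cases α hα y with ⟨h1, h2⟩ | ⟨h1, h2⟩
    · have := inc y h1 h2
      rw [height, height, if_neg h, if_neg (by rw [h1]; exact h)]
      linarith
    · have := (key y).2
      rw [height, height, if_neg h, if_pos (h1.2 h), h2]
      simpa using this

/-- The circular fence poset: its order is generated by the relations between cyclically
adjacent nodes. -/
instance : PartialOrder (CircularFence α hα) where
  le := Relation.ReflTransGen (Step α)
  le_refl _ := Relation.ReflTransGen.refl
  le_trans _ _ _ := Relation.ReflTransGen.trans
  le_antisymm x y hxy hyx := by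
    have mono : ∀ u v : Fin n, Relation.TransGen (Step α) u v → height α u < height α v := by
      intro u v huv
      induction huv with
      | single h => exact height_lt α hα h
      | tail _ h ih => exact ih.trans (height_lt α hα h)
    rcases Relation.reflTransGen_iff_eq_or_transGen.1 hxy with h | h
    · exact h.symm
    rcases Relation.reflTransGen_iff_eq_or_transGen.1 hyx with h' | h'
    · exact h'
    exact absurd (mono _ _ h) (mono _ _ h').asymm

/-- The rank sequence of the circular fence: `rankSeq α hα k` is the coefficient of `q ^ k` in the
rank polynomial of the circular fence, for `k = 0, …, n`. -/
noncomputable def rankSeq {n : ℕ} (α : Composition n) (hα : Even α.length) (k : ℕ) : ℕ :=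
  (rankPolynomial (CircularFence α hα)).coeff k

end CircularFence

/-! Order ideals of a fence are counted by products of 2×2 transfer matrices, and closing the fence
to a circle takes the trace. Up to a factor `T 1`, `twist` intertwines each step matrix with its
image under `q ↦ q⁻¹`, so circular rank sequences are palindromic (`trace_wordMatrix`). The node
`x_1` of the circular fence is a valley. Splitting on whether `x_1` lies in the ideal writes the
trace as a rank polynomial of a shorter linear fence plus `q` times that of the linear fence on the
other `n - 1` nodes. Both decrease past `n / 2` once coefficients of linear fences are known to
decrease away from their centre (`isInterlacing_linearRank`); the lower half follows by symmetry.
The second summand is centred at `(n + 1) / 2`, so for even `n` nothing is said about the middle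
term. The linear statement goes by induction on length: closing a linear fence by a step, a peak or
a valley gives a palindromic trace, which differs from the linear polynomial (shifted, for a valley)
by zero or a shifted polynomial of a shorter fence. -/

namespace FenceWord

open LaurentPolynomial

/-! ### Transfer matrices of fences -/

/-- The transfer matrix of an up step (`true`) or a down step (`false`) of a fence: rows and columns
record whether the two nodes belong to the ideal, and the first node is weighted by `q = T 1`. -/
noncomputable def stepMatrix : Bool → Matrix (Fin 2) (Fin 2) ℤ[T;T⁻¹]
  | true => !![1, 0; T 1, T 1]
  | false => !![1, 1; 0, T 1]

/-- The product of the transfer matrices of a word of steps. -/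
noncomputable def wordMatrix (w : List Bool) : Matrix (Fin 2) (Fin 2) ℤ[T;T⁻¹] :=
  (w.map stepMatrix).prod

/-- The rank polynomial of the linear fence with `w.length + 1` nodes whose steps are given by `w`. -/
noncomputable def linearRank (w : List Bool) : ℤ[T;T⁻¹] :=
  wordMatrix w 0 0 + T 1 * wordMatrix w 0 1 + wordMatrix w 1 0 + T 1 * wordMatrix w 1 1

/-- `p` is the rank polynomial of a linear fence with `N` nodes, possibly the empty one. -/
def IsLinearRank (N : ℤ) (p : ℤ[T;T⁻¹]) : Prop :=
  (N = 0 ∧ p = 1) ∨ ∃ w : List Bool, N = w.length + 1 ∧ p = linearRank w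

theorem coeff_T_mul (k : ℤ) (p : ℤ[T;T⁻¹]) (i : ℤ) : (T k * p).coeff i = p.coeff (i - k) := by
  have h := AddMonoidAlgebra.coeff_single_mul_add p (1 : ℤ) k (i - k)
  rw [add_sub_cancel, one_mul] at h
  exact h

theorem wordMatrix_nil : wordMatrix [] = 1 := rfl

theorem wordMatrix_cons (b : Bool) (w : List Bool) :
    wordMatrix (b :: w) = stepMatrix b * wordMatrix w := by
  simp [wordMatrix]

theorem wordMatrix_append (v w : List Bool) :
    wordMatrix (v ++ w) = wordMatrix v * wordMatrix w := by
  simp [wordMatrix]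

theorem wordMatrix_concat (w : List Bool) (b : Bool) :
    wordMatrix (w ++ [b]) = wordMatrix w * stepMatrix b := by
  simp [wordMatrix]

/-! ### Restricting the first or the last node of a linear fence -/

/-- A first node outside the ideal forces out every node of the initial run of up steps; what
follows the first down step is an unrestricted fence `w'`. The first alternative is a word without
down steps. -/
theorem row_zero (w : List Bool) :
    (∀ j, wordMatrix w 0 j = if j = 0 then 1 else 0) ∨
    ∃ w' : List Bool, w'.length < w.length ∧
      ∀ j, wordMatrix w 0 j = wordMatrix w' 0 j + wordMatrix w' 1 j := by
  induction w with
  | nil => exact Or.inl fun j => by simp [wordMatrix_nil, Matrix.one_apply, eq_comm]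
  | cons b w ih =>
    cases b with
    | false =>
      refine Or.inr ⟨w, by simp, fun j => ?_⟩
      simp [wordMatrix_cons, stepMatrix, Matrix.mul_apply, Fin.sum_univ_two]
    | true =>
      have h : ∀ j, wordMatrix (true :: w) 0 j = wordMatrix w 0 j := fun j => by
        simp [wordMatrix_cons, stepMatrix, Matrix.mul_apply, Fin.sum_univ_two]
      refine ih.imp (fun ih j => (h j).trans (ih j)) ?_
      rintro ⟨w', hw, ih⟩
      exact ⟨w', hw.trans (by simp), fun j => (h j).trans (ih j)⟩

theorem row_one (w : List Bool) :
    (∀ j, wordMatrix w 1 j = if j = 1 then T (w.length : ℤ) else 0) ∨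
    ∃ w' : List Bool, w'.length < w.length ∧
      ∀ j, wordMatrix w 1 j =
        T ((w.length : ℤ) - w'.length) * (wordMatrix w' 0 j + wordMatrix w' 1 j) := by
  induction w with
  | nil => exact Or.inl fun j => by simp [wordMatrix_nil, Matrix.one_apply, eq_comm]
  | cons b w ih =>
    cases b with
    | true =>
      refine Or.inr ⟨w, by simp, fun j => ?_⟩
      simp [wordMatrix_cons, stepMatrix, Matrix.mul_apply, Fin.sum_univ_two, mul_add]
    | false =>
      have h : ∀ j, wordMatrix (false :: w) 1 j = T 1 * wordMatrix w 1 j := fun j => by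
        simp [wordMatrix_cons, stepMatrix, Matrix.mul_apply, Fin.sum_univ_two]
      refine ih.imp (fun ih j => ?_) ?_
      · rw [h, ih]
        split_ifs
        · rw [← T_add]; congr 1; push_cast [List.length_cons]; ring
        · simp
      rintro ⟨w', hw, ih⟩
      refine ⟨w', hw.trans (by simp), fun j => ?_⟩
      rw [h, ih, ← mul_assoc, ← T_add]
      congr 2; push_cast [List.length_cons]; ring

theorem col_zero (w : List Bool) :
    (∀ i, wordMatrix w i 0 = if i = 0 then 1 else 0) ∨
    ∃ w' : List Bool, w'.length < w.length ∧
      ∀ i, wordMatrix w i 0 = wordMatrix w' i 0 + T 1 * wordMatrix w' i 1 := by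
  induction w using List.reverseRecOn with
  | nil => exact Or.inl fun j => by simp [wordMatrix_nil, Matrix.one_apply]
  | append_singleton w b ih =>
    cases b with
    | true =>
      refine Or.inr ⟨w, by simp, fun j => ?_⟩
      simp [wordMatrix_concat, stepMatrix, Matrix.mul_apply, Fin.sum_univ_two]
    | false =>
      have h : ∀ i, wordMatrix (w ++ [false]) i 0 = wordMatrix w i 0 := fun j => by
        simp [wordMatrix_concat, stepMatrix, Matrix.mul_apply, Fin.sum_univ_two]
      refine ih.imp (fun ih j => (h j).trans (ih j)) ?_
      rintro ⟨w', hw, ih⟩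
      exact ⟨w', hw.trans (by simp), fun j => (h j).trans (ih j)⟩

/-- The exponent is one less than the number of nodes forced in, since `wordMatrix` does not weight
the last node. -/
theorem col_one (w : List Bool) :
    (∀ i, wordMatrix w i 1 = if i = 1 then T (w.length : ℤ) else 0) ∨
    ∃ w' : List Bool, w'.length < w.length ∧
      ∀ i, wordMatrix w i 1 = T ((w.length : ℤ) - w'.length - 1) *
        (wordMatrix w' i 0 + T 1 * wordMatrix w' i 1) := by
  induction w using List.reverseRecOn with
  | nil => exact Or.inl fun j => by simp [wordMatrix_nil, Matrix.one_apply]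
  | append_singleton w b ih =>
    cases b with
    | false =>
      refine Or.inr ⟨w, by simp, fun j => ?_⟩
      simp [wordMatrix_concat, stepMatrix, Matrix.mul_apply, Fin.sum_univ_two]
    | true =>
      have h : ∀ i, wordMatrix (w ++ [true]) i 1 = T 1 * wordMatrix w i 1 := fun j => by
        simp [wordMatrix_concat, stepMatrix, Matrix.mul_apply, Fin.sum_univ_two]
      refine ih.imp (fun ih j => ?_) ?_
      · rw [h, ih]
        split_ifs
        · rw [← T_add]; congr 1; push_cast [List.length_append, List.length_singleton]; ring
        · simp
      rintro ⟨w', hw, ih⟩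
      refine ⟨w', hw.trans (by simp), fun j => ?_⟩
      rw [h, ih, ← mul_assoc, ← T_add]
      congr 2; push_cast [List.length_append, List.length_singleton]; ring_nf

theorem entry_zero_zero (w : List Bool) :
    ∃ l : ℤ, 1 ≤ l ∧ IsLinearRank (w.length + 1 - l) (wordMatrix w 0 0) := by
  rcases row_zero w with h | ⟨w', hw, h⟩
  · exact ⟨w.length + 1, by omega, Or.inl ⟨by ring, by simp [h]⟩⟩
  rcases col_zero w' with h' | ⟨w'', hw', h'⟩
  · exact ⟨w.length + 1, by omega, Or.inl ⟨by ring, by simp [h, h']⟩⟩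
  · refine ⟨w.length - w''.length, by omega, Or.inr ⟨w'', by ring, ?_⟩⟩
    rw [h, h', h', linearRank]; ring

theorem entry_one_one (w : List Bool) :
    ∃ k : ℤ, 1 ≤ k ∧ ∃ p, T 1 * wordMatrix w 1 1 = T k * p ∧
      IsLinearRank (w.length + 1 - k) p := by
  rcases row_one w with h | ⟨w', hw, h⟩
  · refine ⟨w.length + 1, by omega, 1, ?_, Or.inl ⟨by ring, rfl⟩⟩
    rw [h, if_pos rfl, ← T_add, mul_one, add_comm]
  rcases col_one w' with h' | ⟨w'', hw', h'⟩
  · refine ⟨w.length + 1, by omega, 1, ?_, Or.inl ⟨by ring, rfl⟩⟩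
    rw [h, h', h', if_pos rfl, if_neg (by simp), zero_add, ← T_add, ← T_add, mul_one]
    congr 1; ring
  · refine ⟨w.length - w''.length, by omega, linearRank w'', ?_, Or.inr ⟨w'', by ring, rfl⟩⟩
    rw [h, h', h', ← mul_add, ← mul_assoc, ← mul_assoc, ← T_add, ← T_add, linearRank]
    congr 1
    · congr 1; ring
    · ring

/-- Here `k` counts the nodes forced in at the start and `l` those forced out at the end. The entry
vanishes when all steps go down. -/
theorem entry_one_zero (w : List Bool) :
    wordMatrix w 1 0 = 0 ∨ ∃ k l : ℤ, 1 ≤ k ∧ 1 ≤ l ∧ ∃ p, wordMatrix w 1 0 = T k * p ∧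
      IsLinearRank (w.length + 1 - k - l) p := by
  rcases row_one w with h | ⟨w', hw, h⟩
  · exact Or.inl (by simp [h])
  refine Or.inr ?_
  rcases col_zero w' with h' | ⟨w'', hw', h'⟩
  · refine ⟨w.length - w'.length, w'.length + 1, by omega, by omega, 1, ?_,
      Or.inl ⟨by ring, rfl⟩⟩
    rw [h, h', h', if_pos rfl, if_neg (by simp), add_zero]
  · refine ⟨w.length - w'.length, w'.length - w''.length, by omega, by omega, linearRank w'', ?_,
      Or.inr ⟨w'', by ring, rfl⟩⟩
    rw [h, h', h', linearRank]; ring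

/-! ### Symmetry of the traces -/

/-- A matrix that intertwines every transfer matrix with its image under `q ↦ q⁻¹`. -/
noncomputable def twist : Matrix (Fin 2) (Fin 2) ℤ[T;T⁻¹] :=
  !![T 1, T 1 - 1; 1 - T 1, 1]

theorem twist_mul_stepMatrix (b : Bool) :
    twist * stepMatrix b = (T 1 : ℤ[T;T⁻¹]) • (stepMatrix b).map (invert (R := ℤ)) * twist := by
  have h : (T 1 * T (-1) : ℤ[T;T⁻¹]) = 1 := by rw [← T_add]; simp
  cases b <;> ext1 i j <;> fin_cases i <;> fin_cases j <;>
    simp [twist, stepMatrix, Matrix.mul_apply, Fin.sum_univ_two, h] <;> ring_nf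

theorem twist_mul_wordMatrix (w : List Bool) :
    twist * wordMatrix w =
      (T (w.length : ℤ) : ℤ[T;T⁻¹]) • (wordMatrix w).map (invert (R := ℤ)) * twist := by
  induction w with
  | nil => simp [wordMatrix_nil]
  | cons b w ih =>
    rw [wordMatrix_cons, ← mul_assoc, twist_mul_stepMatrix, mul_assoc, ih, ← mul_assoc,
      Matrix.map_mul, Matrix.smul_mul, Matrix.mul_smul, smul_smul, ← T_add]
    congr 3; push_cast [List.length_cons]; ring

theorem det_twist_ne_zero : twist.det ≠ 0 := by
  intro h
  have h' : twist.det = T 2 - T 1 + 1 := by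
    have : (T 2 : ℤ[T;T⁻¹]) = T 1 * T 1 := by rw [← T_add]; rfl
    rw [this, twist, Matrix.det_fin_two_of]; ring
  have := congrArg (fun p : ℤ[T;T⁻¹] => p.coeff 2) (h'.symm.trans h)
  simp [← T_zero] at this

/-- The determinant of `twist` is not a unit, so conjugation is replaced by multiplication with the
adjugate, and the determinant is cancelled in the domain of Laurent polynomials. -/
theorem trace_wordMatrix (w : List Bool) :
    (wordMatrix w).trace = T (w.length : ℤ) * invert (wordMatrix w).trace := by
  apply mul_left_cancel₀ det_twist_ne_zero
  have h : twist.det • (wordMatrix w).trace =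
      (twist.adjugate * ((T (w.length : ℤ) : ℤ[T;T⁻¹]) • (wordMatrix w).map (invert (R := ℤ)) * twist)).trace := by
    rw [← twist_mul_wordMatrix, ← mul_assoc, Matrix.adjugate_mul, Matrix.smul_mul, one_mul,
      Matrix.trace_smul]
  rw [Matrix.trace_mul_comm, mul_assoc, Matrix.mul_adjugate, Matrix.mul_smul, mul_one,
    Matrix.trace_smul, Matrix.trace_smul, smul_eq_mul, smul_eq_mul, smul_eq_mul] at h
  rw [h]
  congr 2
  simp [Matrix.trace, Fin.sum_univ_two]

theorem coeff_trace_wordMatrix (w : List Bool) {i j : ℤ} (h : i + j = w.length) :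
    (wordMatrix w).trace.coeff i = (wordMatrix w).trace.coeff j := by
  rw [trace_wordMatrix, coeff_T_mul, invert_apply, ← trace_wordMatrix]
  congr 1; omega

/-- The closing step excludes exactly the ideals containing the first node but not the last. -/
theorem trace_concat_up (w : List Bool) :
    (wordMatrix (w ++ [true])).trace + wordMatrix w 1 0 = linearRank w := by
  simp [wordMatrix_concat, stepMatrix, Matrix.trace, Matrix.mul_apply, Fin.sum_univ_two,
    linearRank]
  ring

theorem trace_concat_peak (w : List Bool) :
    (wordMatrix (w ++ [true, false])).trace =
      linearRank w + T 1 * (T 1 * wordMatrix w 1 1) := by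
  have h : (T 2 : ℤ[T;T⁻¹]) = T 1 * T 1 := by rw [← T_add]; rfl
  simp [h, wordMatrix_append, wordMatrix_cons, wordMatrix_nil, stepMatrix, Matrix.trace,
    Matrix.mul_apply, Fin.sum_univ_two, linearRank]
  ring

theorem trace_concat_valley (w : List Bool) :
    (wordMatrix (w ++ [false, true])).trace = wordMatrix w 0 0 + T 1 * linearRank w := by
  simp [wordMatrix_append, wordMatrix_cons, wordMatrix_nil, stepMatrix, Matrix.trace,
    Matrix.mul_apply, Fin.sum_univ_two, linearRank]
  ring

/-! ### Interlacing of the coefficients of linear fences -/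

/-- The terms of `c` decrease with the distance of the index from `N / 2`, where pairs of indices
at equal distance all compare in the same direction. -/
structure IsInterlacing (N : ℤ) (c : ℤ → ℤ) : Prop where
  low : ∀ i j, i ≤ j → i + j < N → c i ≤ c j
  high : ∀ i j, j ≤ i → N < i + j → c i ≤ c j
  mid : (∀ i j, i ≤ j → i + j = N → c i ≤ c j) ∨ (∀ i j, i ≤ j → i + j = N → c j ≤ c i)

theorem isInterlacing_one : IsInterlacing 0 (fun i => (1 : ℤ[T;T⁻¹]).coeff i) := by
  have h : ∀ i, (1 : ℤ[T;T⁻¹]).coeff i = if i = 0 then 1 else 0 := fun i => by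
    rw [← T_zero, T_apply]; simp [eq_comm]
  simp only [h]
  refine ⟨fun i j _ _ => ?_, fun i j _ _ => ?_, Or.inl fun i j _ _ => ?_⟩ <;>
    split_ifs <;> omega

/-- Two reflections, one about `N / 2` and one about `(N ± 1) / 2`, compose to a shift by one; the
direction in `h₃` decides which pair gives monotonicity on a half. -/
theorem IsInterlacing.of_adjacent {N : ℤ} {c : ℤ → ℤ}
    (h₁ : ∀ i j, i ≤ j → i + j = N + 1 → c j ≤ c i)
    (h₂ : ∀ i j, i ≤ j → i + j = N - 1 → c i ≤ c j)
    (h₃ : (∀ i j, i ≤ j → i + j = N → c i ≤ c j) ∨ (∀ i j, i ≤ j → i + j = N → c j ≤ c i)) :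
    IsInterlacing N c := by
  have mono : ∀ i j, i ≤ j → 2 * j ≤ N → c i ≤ c j := by
    intro i j hij
    induction j, hij using Int.leInduction with
    | base => exact fun _ => le_rfl
    | succ j hij ih =>
      refine fun hj => (ih (by omega)).trans ?_
      rcases h₃ with h | h
      · exact (h j (N - j) (by omega) (by omega)).trans
          (h₁ (j + 1) (N - j) (by omega) (by omega))
      · exact (h₂ j (N - 1 - j) (by omega) (by omega)).trans
          (h (j + 1) (N - 1 - j) (by omega) (by omega))
  have anti : ∀ i j, i ≤ j → N ≤ 2 * i → c j ≤ c i := by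
    intro i j hij hi
    induction j, hij using Int.leInduction with
    | base => exact le_rfl
    | succ j hij ih =>
      refine le_trans ?_ ih
      rcases h₃ with h | h
      · exact (h₁ (N - j) (j + 1) (by omega) (by omega)).trans
          (h (N - j) j (by omega) (by omega))
      · exact (h (N - 1 - j) (j + 1) (by omega) (by omega)).trans
          (h₂ (N - 1 - j) j (by omega) (by omega))
  refine ⟨fun i j hij hN => ?_, fun i j hij hN => ?_, h₃⟩
  · by_cases hj : 2 * j ≤ N
    · exact mono i j hij hj
    · exact (mono i (N - 1 - j) (by omega) (by omega)).trans (h₂ _ _ (by omega) (by omega))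
  · by_cases hj : N ≤ 2 * j
    · exact anti j i hij hj
    · exact (anti (N + 1 - j) i (by omega) (by omega)).trans (h₁ _ _ (by omega) (by omega))

theorem isInterlacing_linearRank (w : List Bool) :
    IsInterlacing (w.length + 1) (fun i => (linearRank w).coeff i) := by
  induction hn : w.length using Nat.strong_induction_on generalizing w with
  | _ n ih =>
  subst hn
  have ih' : ∀ N : ℤ, N ≤ w.length → ∀ p, IsLinearRank N p →
      IsInterlacing N (fun i => p.coeff i) := by
    rintro N hN p (⟨rfl, rfl⟩ | ⟨v, rfl, rfl⟩)
    · exact isInterlacing_one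
    · exact ih _ (by omega) v rfl
  apply IsInterlacing.of_adjacent
  -- Close with a peak: the trace is symmetric about half of `w.length + 2`.
  · intro i j hij hs
    obtain ⟨k, hk, p, hp, hN⟩ := entry_one_one w
    have hc := coeff_trace_wordMatrix (w ++ [true, false]) (i := i) (j := j) (by simp; omega)
    have hle := (ih' _ (by omega) p hN).low (i - 1 - k) (j - 1 - k) (by omega) (by omega)
    simp only [trace_concat_peak, hp, AddMonoidAlgebra.coeff_add, Finsupp.add_apply,
      coeff_T_mul] at hc
    linarith
  -- Close with a valley; the factor `T 1` on the linear part shifts the indices by one.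
  · intro i j hij hs
    obtain ⟨l, hl, hN⟩ := entry_zero_zero w
    have hc := coeff_trace_wordMatrix (w ++ [false, true]) (i := i + 1) (j := j + 1)
      (by simp; omega)
    have hle := (ih' _ (by omega) _ hN).high (j + 1) (i + 1) (by omega) (by omega)
    simp only [trace_concat_valley, AddMonoidAlgebra.coeff_add, Finsupp.add_apply,
      coeff_T_mul, add_sub_cancel_right] at hc
    linarith
  · have hc : ∀ i j : ℤ, i + j = w.length + 1 →
        (linearRank w).coeff i - (wordMatrix w 1 0).coeff i =
          (linearRank w).coeff j - (wordMatrix w 1 0).coeff j := by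
      intro i j hs
      have := coeff_trace_wordMatrix (w ++ [true]) (i := i) (j := j) (by simp; omega)
      simp only [← trace_concat_up, AddMonoidAlgebra.coeff_add, Finsupp.add_apply]
      linarith
    rcases entry_one_zero w with h | ⟨k, l, hk, hl, p, hp, hN⟩
    · refine Or.inl fun i j _ hs => ?_
      have := hc i j hs
      simp [h] at this
      exact this.le
    simp only [hp, coeff_T_mul] at hc
    have hI := ih' _ (by omega) p hN
    -- `T k * p` is centred `(k - l) / 2` to the right of the centre of `linearRank w`, so the sign
    -- of `k - l` decides the direction; for `k = l` it is inherited from `p`.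
    rcases lt_trichotomy l k with h | h | h
    · refine Or.inl fun i j hij hs => ?_
      have := hc i j hs
      have := hI.low (i - k) (j - k) (by omega) (by omega)
      linarith
    · refine hI.mid.imp (fun hm i j hij hs => ?_) (fun hm i j hij hs => ?_)
      all_goals
        have := hc i j hs
        have := hm (i - k) (j - k) (by omega) (by omega)
        linarith
    · refine Or.inr fun i j hij hs => ?_
      have := hc i j hs
      have := hI.high (j - k) (i - k) (by omega) (by omega)
      linarith

theorem IsLinearRank.isInterlacing {N : ℤ} {p : ℤ[T;T⁻¹]} (h : IsLinearRank N p) :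
    IsInterlacing N (fun i => p.coeff i) := by
  rcases h with ⟨rfl, rfl⟩ | ⟨w, rfl, rfl⟩
  · exact isInterlacing_one
  · exact isInterlacing_linearRank w

/-- The coefficients of the rank polynomial of a circular fence that starts with an up step and
ends with a down step decrease beyond the middle. -/
theorem coeff_trace_succ_le (w : List Bool) {i : ℤ} (hi : w.length + 2 < 2 * i) :
    (wordMatrix (true :: (w ++ [false]))).trace.coeff (i + 1) ≤
      (wordMatrix (true :: (w ++ [false]))).trace.coeff i := by
  -- Cyclic invariance of the trace moves the initial up step to the end, exposing the valley.
  have h : (wordMatrix (true :: (w ++ [false]))).trace = wordMatrix w 0 0 + T 1 * linearRank w := by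
    rw [← trace_concat_valley, ← List.singleton_append, wordMatrix_append, Matrix.trace_mul_comm,
      ← wordMatrix_append, List.append_assoc, List.singleton_append]
  obtain ⟨l, hl, hN⟩ := entry_zero_zero w
  have h₁ := hN.isInterlacing.high (i + 1) i (by omega) (by omega)
  have h₂ := (isInterlacing_linearRank w).high i (i - 1) (by omega) (by omega)
  simp only [h, AddMonoidAlgebra.coeff_add, Finsupp.add_apply, coeff_T_mul, add_sub_cancel_right]
  exact add_le_add h₁ h₂

/-! ### Matrix products as sums over walks -/

/-- The endpoint weight `f` is arbitrary so that the induction can absorb the first matrix into it;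
later it holds the matrix that closes the walk. -/
theorem sum_prod_path {κ R : Type*} [Fintype κ] [DecidableEq κ] [CommSemiring R] {m : ℕ}
    (A : Fin m → Matrix κ κ R) (f : κ → κ → R) :
    ∑ x : Fin (m + 1) → κ, (∏ i : Fin m, A i (x i.castSucc) (x i.succ)) * f (x 0) (x (Fin.last m)) =
      ∑ a, ∑ b, (List.ofFn A).prod a b * f a b := by
  induction m generalizing f with
  | zero =>
    rw [Fintype.sum_equiv (Equiv.funUnique (Fin 1) κ) _ (fun a => f a a) (fun x => by simp)]
    simp [Matrix.one_apply]
  | succ m ih =>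
    rw [← (Fin.consEquiv fun _ => κ).sum_comp, Fintype.sum_prod_type, Finset.sum_comm]
    have h : ∀ y : Fin (m + 1) → κ, ∑ a, (∏ i : Fin (m + 1),
          A i (Fin.cons (α := fun _ => κ) a y i.castSucc) (Fin.cons (α := fun _ => κ) a y i.succ)) *
          f (Fin.cons (α := fun _ => κ) a y 0) (Fin.cons (α := fun _ => κ) a y (Fin.last (m + 1))) =
        (∏ i : Fin m, A i.succ (y i.castSucc) (y i.succ)) *
          ∑ a, A 0 a (y 0) * f a (y (Fin.last m)) := by
      intro y
      rw [Finset.mul_sum]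
      refine Finset.sum_congr rfl fun a _ => ?_
      rw [Fin.prod_univ_succ, ← Fin.succ_last]
      simp only [← Fin.succ_castSucc, Fin.cons_succ, Fin.castSucc_zero, Fin.cons_zero]
      ring
    refine (Finset.sum_congr rfl fun y _ => h y).trans ?_
    rw [ih (fun i => A i.succ) (fun c b => ∑ a, A 0 a c * f a b)]
    simp only [List.ofFn_succ, List.prod_cons, Matrix.mul_apply, Finset.sum_mul, Finset.mul_sum]
    rw [Finset.sum_comm]
    conv_rhs => rw [Finset.sum_comm]
    refine Finset.sum_congr rfl fun b _ => ?_
    rw [Finset.sum_comm]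
    exact Finset.sum_congr rfl fun a _ => Finset.sum_congr rfl fun c _ => by ring

/-- The trace of a product of matrices as a sum over closed walks. -/
theorem sum_prod_closedWalk {κ R : Type*} [Fintype κ] [DecidableEq κ] [CommSemiring R] {n : ℕ}
    (A : Fin (n + 1) → Matrix κ κ R) :
    ∑ x : Fin (n + 1) → κ, ∏ i, A i (x i) (x (finRotate (n + 1) i)) =
      (List.ofFn A).prod.trace := by
  have h : ∀ x : Fin (n + 1) → κ, ∏ i, A i (x i) (x (finRotate (n + 1) i)) =
      (∏ i : Fin n, A i.castSucc (x i.castSucc) (x i.succ)) *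
        A (Fin.last n) (x (Fin.last n)) (x 0) := by
    intro x
    rw [Fin.prod_univ_castSucc]
    simp
  simp only [h]
  rw [sum_prod_path (fun i => A i.castSucc) fun a b => A (Fin.last n) b a, List.ofFn_succ',
    List.concat_eq_append, List.prod_append, List.prod_singleton]
  simp [Matrix.trace, Matrix.mul_apply]

end FenceWord

/-! ### The rank sequence of a circular fence as a trace -/

namespace CircularFence

open LaurentPolynomial FenceWord

variable {n : ℕ} {α : Composition n} {hα : Even α.length}

/-- The word of steps of a circular fence, `true` standing for an up step. -/
noncomputable def stepWord (α : Composition n) : List Bool :=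
  List.ofFn fun i => decide (Even (α.index i : ℕ))

theorem isLowerSet_iff (I : Set (CircularFence α hα)) :
    IsLowerSet I ↔ ∀ i : Fin n, if Even (α.index i : ℕ)
      then finRotate n i ∈ I → i ∈ I else i ∈ I → finRotate n i ∈ I := by
  constructor
  · intro h i
    split_ifs with hi
    · exact h (a := finRotate n i) (b := i) (Relation.ReflTransGen.single (Or.inl ⟨rfl, hi⟩))
    · exact h (a := i) (b := finRotate n i)
        (Relation.ReflTransGen.single (Or.inr ⟨rfl, Nat.not_even_iff_odd.1 hi⟩))
  · intro h
    have step : ∀ x y : Fin n, Step α x y → y ∈ I → x ∈ I := by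
      rintro x y (⟨rfl, hx⟩ | ⟨rfl, hy⟩)
      · simpa [hx] using h x
      · simpa [Nat.not_even_iff_odd.2 hy] using h y
    intro a b hba ha
    change Relation.ReflTransGen (Step α) b a at hba
    induction hba using Relation.ReflTransGen.head_induction_on with
    | refl => exact ha
    | head hs _ ih => exact step _ _ hs ih

theorem stepMatrix_apply_indicator (c P Q : Prop) [Decidable c] [Decidable P] [Decidable Q]
    [Decidable (if c then Q → P else P → Q)] :
    stepMatrix (decide c) (if P then 1 else 0) (if Q then 1 else 0) =
      if (if c then Q → P else P → Q) then (if P then T 1 else 1) else 0 := by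
  by_cases c <;> by_cases P <;> by_cases Q <;> simp [stepMatrix, *]

theorem rankPolynomial_eq_sum :
    rankPolynomial (CircularFence α hα) = ∑ I : Finset (Fin n),
      if ∀ i : Fin n, if Even (α.index i : ℕ) then finRotate n i ∈ I → i ∈ I
        else i ∈ I → finRotate n i ∈ I then Polynomial.X ^ I.card else 0 := by
  classical
  rw [rankPolynomial, Finset.sum_filter]
  refine Finset.sum_congr rfl fun I _ => ?_
  have h := isLowerSet_iff (I : Set (CircularFence α hα))
  by_cases hI : IsLowerSet (I : Set (CircularFence α hα))
  · exact (if_pos hI).trans (if_pos (h.1 hI)).symm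
  · exact (if_neg hI).trans (if_neg fun h' => hI (h.2 h')).symm

/-- Closed walks on `Fin 2` are indicator functions of node sets, and a walk has nonzero weight
exactly when the set is an ideal. For `n = 0` the empty product has trace 2, while the rank
polynomial is 1. -/
theorem rankPolynomial_eq_trace (hn : n ≠ 0) :
    Polynomial.toLaurent ((rankPolynomial (CircularFence α hα)).map (Nat.castRingHom ℤ)) =
      (wordMatrix (stepWord α)).trace := by
  obtain ⟨m, rfl⟩ := Nat.exists_eq_succ_of_ne_zero hn
  rw [wordMatrix, stepWord, List.map_ofFn, ← sum_prod_closedWalk, rankPolynomial_eq_sum,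
    Polynomial.map_sum, map_sum]
  refine Finset.sum_bij' (fun I _ => fun i : Fin (m + 1) => if i ∈ I then (1 : Fin 2) else 0)
    (fun x _ => Finset.univ.filter fun i : Fin (m + 1) => x i = 1)
    (by simp) (by simp) ?_ ?_ ?_
  · intro I _
    ext i
    simp
  · intro x _
    ext1 i
    simp only [Finset.mem_filter_univ]
    split_ifs <;> omega
  · intro I _
    have h : (∏ i : Fin (m + 1), if i ∈ I then (T 1 : ℤ[T;T⁻¹]) else 1) = T 1 ^ I.card := by
      simp
    simp only [Function.comp_apply, stepMatrix_apply_indicator, Finset.prod_ite_zero, h,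
      Finset.mem_univ, true_implies, Nat.succ_eq_add_one]
    split_ifs <;> simp

theorem coeff_trace_stepWord (hn : n ≠ 0) (k : ℕ) :
    (wordMatrix (stepWord α)).trace.coeff k = rankSeq α hα k := by
  rw [← rankPolynomial_eq_trace (hα := hα) hn, rankSeq, LaurentPolynomial.coeff_toLaurent]
  exact (Finsupp.mapDomain_apply Nat.cast_injective _ _).trans (Polynomial.coeff_map _ _)

/-- The first segment has number 0 and the last has number `α.length - 1`, which is odd. -/
theorem exists_stepWord_eq (hα : Even α.length) (hn : n ≠ 0) :
    ∃ w : List Bool, w.length + 2 = n ∧ stepWord α = true :: (w ++ [false]) := by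
  have hpos : 0 < α.length := α.length_pos_iff.2 (by omega)
  have hlen : 2 ≤ n := by
    have := α.length_le
    obtain ⟨r, hr⟩ := hα
    omega
  obtain ⟨m, rfl⟩ := Nat.exists_eq_add_of_le' hlen
  have h0 : Even (α.index 0 : ℕ) := by
    have h : α.index 0 = ⟨0, hpos⟩ := by
      refine (α.mem_range_embedding_iff'.1 (α.mem_range_embedding_iff.2 ⟨?_, ?_⟩)).symm
      · simp
      · have := α.sizeUpTo_strict_mono hpos
        rw [α.sizeUpTo_zero] at this
        exact this
    rw [h]
    exact Even.zero
  have h1 : ¬ Even (α.index (Fin.last (m + 1)) : ℕ) := by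
    have hi : (Fin.last (m + 1) : ℕ) < α.sizeUpTo ((α.index (Fin.last (m + 1)) : ℕ) + 1) :=
      α.lt_sizeUpTo_index_succ _
    rw [Fin.val_last] at hi
    have hl : (α.index (Fin.last (m + 1)) : ℕ) + 1 = α.length := by
      by_contra hne
      have := (α.index (Fin.last (m + 1))).2
      have := α.sizeUpTo_strict_mono
        (show (α.index (Fin.last (m + 1)) : ℕ) + 1 < α.length by omega)
      have := α.sizeUpTo_le ((α.index (Fin.last (m + 1)) : ℕ) + 1 + 1)
      omega
    rwa [← hl, Nat.even_add_one] at hα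
  refine ⟨List.ofFn fun i : Fin m => decide (Even (α.index i.castSucc.succ : ℕ)), by simp, ?_⟩
  rw [stepWord, List.ofFn_succ, List.ofFn_succ', List.concat_eq_append, Fin.succ_last]
  simp [h0, h1]

theorem rankSeq_symm (hn : n ≠ 0) {i j : ℕ} (h : i + j = n) :
    rankSeq α hα i = rankSeq α hα j := by
  have hc := coeff_trace_wordMatrix (stepWord α) (i := i) (j := j)
    (by rw [stepWord, List.length_ofFn]; exact_mod_cast h)
  rw [coeff_trace_stepWord (hα := hα) hn, coeff_trace_stepWord (hα := hα) hn] at hc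
  exact_mod_cast hc

theorem rankSeq_succ_le (hn : n ≠ 0) {i : ℕ} (h : n < 2 * i) :
    rankSeq α hα (i + 1) ≤ rankSeq α hα i := by
  obtain ⟨w, hw, hs⟩ := exists_stepWord_eq hα hn
  have hc := coeff_trace_succ_le w (i := i) (by omega)
  rw [← hs, ← Nat.cast_succ, coeff_trace_stepWord (hα := hα) hn,
    coeff_trace_stepWord (hα := hα) hn] at hc
  exact_mod_cast hc

theorem rankSeq_le_succ (hn : n ≠ 0) {i : ℕ} (h : 2 * i + 2 < n) :
    rankSeq α hα i ≤ rankSeq α hα (i + 1) := by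
  rw [rankSeq_symm hn (show i + (n - 1 - i + 1) = n by omega),
    rankSeq_symm hn (show i + 1 + (n - 1 - i) = n by omega)]
  exact rankSeq_succ_le hn (by omega)

end CircularFence

theorem mainTheorem5 {n : ℕ} (α : Composition n) (hα : Even α.length) :
    (Odd n → IsUnimodal (CircularFence.rankSeq α hα) n) ∧
    (∀ t : ℕ, n = 2 * t →
      (∀ i, 1 ≤ i → i < t →
        CircularFence.rankSeq α hα (i - 1) ≤ CircularFence.rankSeq α hα i) ∧
      (∀ i, t < i → i < n →
        CircularFence.rankSeq α hα (i + 1) ≤ CircularFence.rankSeq α hα i) ∧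
      (¬ IsUnimodal (CircularFence.rankSeq α hα) n →
        CircularFence.rankSeq α hα t < CircularFence.rankSeq α hα (t - 1) ∧
        CircularFence.rankSeq α hα t < CircularFence.rankSeq α hα (t + 1))) := by
  rcases eq_or_ne n 0 with rfl | hn
  · refine ⟨by simp, fun t ht => ⟨fun i _ hi => by omega, fun i _ hi => by omega, fun h => ?_⟩⟩
    exact absurd ⟨0, le_rfl, fun i hi => by omega, fun i _ hi => by omega⟩ h
  refine ⟨?_, ?_⟩
  · rintro ⟨t, ht⟩
    refine ⟨t, by omega, fun i hi => CircularFence.rankSeq_le_succ hn (by omega), fun i hi _ => ?_⟩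
    -- For `n = 2 * t + 1` the two middle terms agree by symmetry.
    rcases hi.eq_or_lt with rfl | hi
    · exact (CircularFence.rankSeq_symm hn (by omega)).le
    · exact CircularFence.rankSeq_succ_le hn (by omega)
  · intro t ht
    refine ⟨fun i h1 hi => ?_, fun i hi _ => CircularFence.rankSeq_succ_le hn (by omega),
      fun hu => ?_⟩
    · obtain ⟨j, rfl⟩ := Nat.exists_eq_add_of_le' h1
      exact CircularFence.rankSeq_le_succ hn (by omega)
    have hsymm : CircularFence.rankSeq α hα (t - 1) = CircularFence.rankSeq α hα (t + 1) :=
      CircularFence.rankSeq_symm hn (by omega)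
    rw [hsymm, and_self]
    -- If the middle term is at least its equal neighbours, the sequence is unimodal with peak at
    -- `t`.
    by_contra! hle
    refine hu ⟨t, by omega, fun i hi => ?_, fun i hi _ => ?_⟩
    · rcases (show i + 1 < t ∨ i = t - 1 by omega) with h | rfl
      · exact CircularFence.rankSeq_le_succ hn (by omega)
      · rw [Nat.sub_add_cancel (by omega), hsymm]
        exact hle
    · rcases hi.eq_or_lt with rfl | hi
      · exact hle
      · exact CircularFence.rankSeq_succ_le hn (by omega)
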